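/- Let $(x_i,\sigma_i,m_i,\epsilon_i)$, $i\ge 1$, be i.i.d. copies of $(x,\sigma,m,\epsilon)$, with values in $\mathbb{R}^p\times\mathbb{R}\times\{1,\dots,M\}\times\mathbb{R}$, where $x$, the pair $(\sigma,m)$, and $\epsilon$ are mutually independent, $\mathbb{E}[\epsilon]=0$ and $\mathrm{Var}(\epsilon)=1$. For a measurable $f:\mathbb{R}^p\to\mathbb{R}$ let $$y_i=f(x_i)+\sigma_i\epsilon_i,\qquad \beta=\mathbb{E}[xx^T]^{-1}\mathbb{E}[xf(x)],\qquad g(x)=f(x)-x^T\beta .$$ Moment conditions: $\mathbb{E}[xx^T]$ has full rank; $\mathbb{E}[x_j^4x_k^4]<\infty$ for all $1\le j,k\le p$; $\mathbb{E}[g(x)^4]<\infty$, $\mathbb{E}[\sigma^4]<\infty$, $\mathbb{E}[\epsilon^4]<\infty$; and $\sigma^2$ is almost surely bounded below by a positive constant. Weights: for each $n$, $\widehat W=\widehat W_n$ is a random $n\times n$ matrix, almost surely diagonal and positive definite, with $$\widehat W_{ii}=w(\sigma_i)+n^{-1/2}\,\delta_{n m_i}\,h(\sigma_i)+n^{-1}d(\sigma_i,\delta_n),\qquad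 1\le i\le n .$$ Here $w,h:\mathbb{R}\to\mathbb{R}$ are measurable and $S\subseteq\mathbb{R}$ is a set with $\sigma_i\in S$ almost surely for every $i$ (for example $S=\mathbb{R}$); $w>0$ on $S$ and $\mathbb{E}[w(\sigma)^4]<\infty$; $h$ is bounded on $S$; for each $k\in\{1,\dots,M\}$ the real random variables $\delta_{nk}$ are $O_P(1)$ as $n\to\infty$; $\delta_n$ is a random element of an arbitrary space; and $\sup_{s\in S}|d(s,\delta_n)|\le\delta_n'$ almost surely for some $\delta_n'=O_P(1)$. The variables $\delta_{nk}$, $\delta_n$, $\delta_n'$ may depend on the data. Let $X$ be the $n\times p$ matrix with rows $x_1^T,\dots,x_n^T$, let $Y=(y_1,\dots,y_n)^T$, and let $$\widehat\beta(\widehat W)=(X^T\widehat WX)^{-1}X^T\widehat WY,$$ set to $0$ when $X^T\widehat WX$ is singular. Then, as $n\to\infty$, $$\sqrt n\,\bigl(\widehat\beta(\widehat W)-\beta\bigr)\ \xrightarrow{\,d\,}\ N(0,\nu(w)),$$ where, writing $w=w(\sigma)$, $g=g(x)$ and $B=\mathbb{E}[xx^T]^{-1}$, $$\nu(w)=\frac{\mathbb{E}[w^2]\;B\,\mathbb{E}[g^2xx^T]\,B+\mathbb{E}[\sigma^2w^2]\;B}{\mathbb{E}[w]^2}.$$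 -/

import Mathlib

open MeasureTheory ProbabilityTheory Filter
open scoped Matrix

namespace MisspecWLS

noncomputable section

/-- `Z n = O_P(1)`: the sequence of real random variables `Z n` is bounded in probability. -/
def BoundedInProbability {Ω : Type*} [MeasurableSpace Ω] (P : Measure Ω) (Z : ℕ → Ω → ℝ) : Prop :=
  ∀ η : ℝ, 0 < η → ∃ K : ℝ, ∀ᶠ n in atTop, P {ω | K < |Z n ω|} ≤ ENNReal.ofReal η

/-- The second moment matrix `E[x xᵀ]` of a random vector `x`. -/
def secondMoment {Ω : Type*} [MeasurableSpace Ω] (P : Measure Ω) {p : ℕ}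
    (x : Ω → EuclideanSpace ℝ (Fin p)) : Matrix (Fin p) (Fin p) ℝ :=
  Matrix.of fun j k => ∫ ω, x ω j * x ω k ∂P

/-- The coefficient vector `β = E[x xᵀ]⁻¹ E[x f(x)]` of the best linear approximation of `f`. -/
def bestCoeff {Ω : Type*} [MeasurableSpace Ω] (P : Measure Ω) {p : ℕ}
    (x : Ω → EuclideanSpace ℝ (Fin p)) (f : EuclideanSpace ℝ (Fin p) → ℝ) :
    EuclideanSpace ℝ (Fin p) :=
  WithLp.toLp 2 ((secondMoment P x)⁻¹ *ᵥ fun j => ∫ ω, x ω j * f (x ω) ∂P)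

/-- The nonlinear component `g(v) = f(v) - vᵀ β` of `f`. -/
def nonlinearPart {Ω : Type*} [MeasurableSpace Ω] (P : Measure Ω) {p : ℕ}
    (x : Ω → EuclideanSpace ℝ (Fin p)) (f : EuclideanSpace ℝ (Fin p) → ℝ)
    (v : EuclideanSpace ℝ (Fin p)) : ℝ :=
  f v - ∑ j, v j * bestCoeff P x f j

/-- The matrix `E[g(x)² x xᵀ]`. -/
def misspecMoment {Ω : Type*} [MeasurableSpace Ω] (P : Measure Ω) {p : ℕ}
    (x : Ω → EuclideanSpace ℝ (Fin p)) (f : EuclideanSpace ℝ (Fin p) → ℝ) :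
    Matrix (Fin p) (Fin p) ℝ :=
  Matrix.of fun j k => ∫ ω, nonlinearPart P x f (x ω) ^ 2 * (x ω j * x ω k) ∂P

/-- The asymptotic variance
`ν(w) = (E[w²] B E[g² x xᵀ] B + E[σ² w²] B) / E[w]²`, with `B = E[x xᵀ]⁻¹`, `w = w(σ)`. -/
def asymptoticVariance {Ω : Type*} [MeasurableSpace Ω] (P : Measure Ω) {p : ℕ}
    (x : Ω → EuclideanSpace ℝ (Fin p)) (σ : Ω → ℝ) (f : EuclideanSpace ℝ (Fin p) → ℝ)
    (w : ℝ → ℝ) : Matrix (Fin p) (Fin p) ℝ :=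
  ((∫ ω, w (σ ω) ∂P) ^ 2)⁻¹ •
    ((∫ ω, w (σ ω) ^ 2 ∂P) •
        ((secondMoment P x)⁻¹ * misspecMoment P x f * (secondMoment P x)⁻¹) +
      (∫ ω, σ ω ^ 2 * w (σ ω) ^ 2 ∂P) • (secondMoment P x)⁻¹)

/-- The design matrix of the first `n` observations: its `i`-th row is `xᵢᵀ`. -/
def designMatrix {Ω : Type*} {p : ℕ} (x : ℕ → Ω → EuclideanSpace ℝ (Fin p)) (n : ℕ) (ω : Ω) :
    Matrix (Fin n) (Fin p) ℝ :=
  Matrix.of fun i j => x i ω j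

/-- The responses `yᵢ = f(xᵢ) + σᵢ εᵢ` of the first `n` observations. -/
def response {Ω : Type*} {p : ℕ} (f : EuclideanSpace ℝ (Fin p) → ℝ)
    (x : ℕ → Ω → EuclideanSpace ℝ (Fin p)) (σ ε : ℕ → Ω → ℝ) (n : ℕ) (ω : Ω) : Fin n → ℝ :=
  fun i => f (x i ω) + σ i ω * ε i ω

/-- The weighted least squares estimator `(Xᵀ W X)⁻¹ Xᵀ W Y`
(equal to `0` when `Xᵀ W X` is singular). -/
def wlsEstimator {n p : ℕ} (X : Matrix (Fin n) (Fin p) ℝ) (W : Matrix (Fin n) (Fin n) ℝ)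
    (Y : Fin n → ℝ) : EuclideanSpace ℝ (Fin p) :=
  WithLp.toLp 2 ((Xᵀ * W * X)⁻¹ *ᵥ (Xᵀ *ᵥ (W *ᵥ Y)))

/-- The sampling model: the tuples `(xᵢ, σᵢ, mᵢ, εᵢ)` are i.i.d. over `i`; within one observation
`x`, the pair `(σ, m)`, and `ε` are mutually independent; `ε` has mean `0` and variance `1`. -/
structure IsSamplingModel {Ω : Type*} [MeasurableSpace Ω] (P : Measure Ω) {p M : ℕ}
    (x : ℕ → Ω → EuclideanSpace ℝ (Fin p)) (σ ε : ℕ → Ω → ℝ) (m : ℕ → Ω → Fin M) : Prop where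
  measurable_x : ∀ i, Measurable (x i)
  measurable_σ : ∀ i, Measurable (σ i)
  measurable_ε : ∀ i, Measurable (ε i)
  measurable_m : ∀ i, Measurable (m i)
  indep : iIndepFun (fun i ω => (x i ω, σ i ω, m i ω, ε i ω)) P
  identDistrib : ∀ i, IdentDistrib (fun ω => (x i ω, σ i ω, m i ω, ε i ω))
    (fun ω => (x 0 ω, σ 0 ω, m 0 ω, ε 0 ω)) P P
  indep_x : IndepFun (x 0) (fun ω => (σ 0 ω, m 0 ω)) P
  indep_ε : IndepFun (ε 0) (fun ω => (x 0 ω, σ 0 ω, m 0 ω)) P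
  mean_ε : ∫ ω, ε 0 ω ∂P = 0
  var_ε : Var[ε 0; P] = 1

/-- The moment conditions on a generic observation `(x, σ, ε)`. -/
structure MomentConditions {Ω : Type*} [MeasurableSpace Ω] (P : Measure Ω) {p : ℕ}
    (x : Ω → EuclideanSpace ℝ (Fin p)) (σ ε : Ω → ℝ) (f : EuclideanSpace ℝ (Fin p) → ℝ) :
    Prop where
  full_rank : (secondMoment P x).rank = p
  moment_x : ∀ j k, Integrable (fun ω => x ω j ^ 4 * x ω k ^ 4) P
  moment_g : Integrable (fun ω => nonlinearPart P x f (x ω) ^ 4) P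
  moment_σ : Integrable (fun ω => σ ω ^ 4) P
  moment_ε : Integrable (fun ω => ε ω ^ 4) P
  variance_lower_bound : ∃ c : ℝ, 0 < c ∧ ∀ᵐ ω ∂P, c ≤ σ ω ^ 2

/-- The weight matrices `W n` are diagonal and positive definite with diagonal entries
`w(σᵢ) + n^{-1/2} δ_{n,mᵢ} h(σᵢ) + n^{-1} d(σᵢ, δ₀ₙ)`. The set `S` contains the possible values
of `σ` (for instance all of `ℝ`); `δ₀ₙ` is a random element of an arbitrary space `D`. -/
structure WeightForm {Ω : Type*} [MeasurableSpace Ω] (P : Measure Ω) {M : ℕ} {D : Type*}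
    (σ : ℕ → Ω → ℝ) (m : ℕ → Ω → Fin M) (W : (n : ℕ) → Ω → Matrix (Fin n) (Fin n) ℝ)
    (S : Set ℝ) (w h : ℝ → ℝ) (d : ℝ → D → ℝ) (δ : ℕ → Fin M → Ω → ℝ) (δ₀ : ℕ → Ω → D) :
    Prop where
  measurable_W : ∀ n i j, Measurable fun ω => W n ω i j
  measurable_w : Measurable w
  measurable_h : Measurable h
  measurable_δ : ∀ n k, Measurable (δ n k)
  isDiag : ∀ n, ∀ᵐ ω ∂P, (W n ω).IsDiag
  posDef : ∀ n, ∀ᵐ ω ∂P, (W n ω).PosDef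
  entries : ∀ n, ∀ᵐ ω ∂P, ∀ i : Fin n,
    W n ω i i = w (σ i ω) + (√(n : ℝ))⁻¹ * δ n (m i ω) ω * h (σ i ω)
      + (n : ℝ)⁻¹ * d (σ i ω) (δ₀ n ω)
  mem_S : ∀ i, ∀ᵐ ω ∂P, σ i ω ∈ S
  w_pos : ∀ s ∈ S, 0 < w s
  moment_w : Integrable (fun ω => w (σ 0 ω) ^ 4) P
  h_bounded : ∃ C : ℝ, ∀ s ∈ S, |h s| ≤ C
  δ_bounded : ∀ k, BoundedInProbability P (fun n => δ n k)
  d_bounded : ∃ δ' : ℕ → Ω → ℝ, BoundedInProbability P δ' ∧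
    ∀ n, ∀ᵐ ω ∂P, ∀ s ∈ S, |d s (δ₀ n ω)| ≤ δ' n ω

end

end MisspecWLS

/-! Put `A_n = n⁻¹ Xᵀ W X` (`weightedGram`) and `s_n = n^{-1/2} Xᵀ W (Y - X β)` (`weightedScore`),
where the residuals are `g(xᵢ) + σᵢ εᵢ`. When `W` is diagonal and `A_n` is invertible, `√n (β̂ - β)
= A_n⁻¹ s_n` exactly (`sqrt_smul_wlsEstimator_sub`). The theorem is then Slutsky's lemma, given `A_n
→ E[w] E[x xᵀ]` in probability (`tendstoInMeasure_weightedGram`) and asymptotic normality of `s_n`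
(`tendstoInDistribution_weightedScore`).

With `w(σᵢ)` in place of the entries of `W`, these are the law of large numbers and the central
limit theorem. The point is that the random perturbation of the weights does not matter, although it
depends on the data and has size `n^{-1/2}`, the scale of the fluctuations. Grouping observations by
category pulls `δ n k` out of the sum and leaves an average of `1{mᵢ = k} h(σᵢ) xᵢ (g(xᵢ) + σᵢ εᵢ)`.
Its mean is zero: `x` is independent of `(σ, m)`, `E[x g(x)] = 0` by the choice of `β`, and `ε` is
independent of the rest and centred (`integral_score`). So each of the finitely many categories
contributes `O_P(1) · o_P(1)`, and the `n⁻¹ d` term is `O_P(n^{-1/2})`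
(`WeightForm.tendstoInMeasure_remainder`).

The covariance of one score is `E[w²] E[g² x xᵀ] + E[σ² w²] E[x xᵀ]`, the cross terms vanishing
because they are linear in `ε` (`integral_score_mul_score`). Multiplying by `(E[w] E[x xᵀ])⁻¹` on
both sides gives `ν(w)`. -/

namespace MisspecWLS

open Topology
open scoped RealInnerProductSpace

/-! ### Calculus of convergence in probability to constants. -/

section ConvergenceInMeasure

variable {α ι : Type*} [MeasurableSpace α] {μ : Measure α} {l : Filter ι}

/-- Deviation events of `Z` lie, up to null sets, in deviation events of `Y`. The two sequences may
live in different spaces, so one can for instance be the determinant of a random matrix. -/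
theorem tendstoInMeasure_of_subset {E F : Type*} [PseudoMetricSpace E] [PseudoMetricSpace F]
    {Y : ι → α → E} {Z : ι → α → F} {a : α → E} {b : α → F}
    (h : TendstoInMeasure μ Y l a)
    (hsub : ∀ ε : ℝ, 0 < ε → ∃ δ : ℝ, 0 < δ ∧ ∀ i, ∀ᵐ ω ∂μ,
      ε ≤ dist (Z i ω) (b ω) → δ ≤ dist (Y i ω) (a ω)) :
    TendstoInMeasure μ Z l b := by
  rw [tendstoInMeasure_iff_dist] at h ⊢
  intro ε hε
  obtain ⟨δ, hδ, H⟩ := hsub ε hε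
  exact tendsto_of_tendsto_of_tendsto_of_le_of_le tendsto_const_nhds (h δ hδ)
    (fun _ => zero_le) fun i => measure_mono_ae (H i)

/-- Continuity at the limit point alone is enough because the limit is constant; this makes it
applicable to matrix inversion. -/
theorem tendstoInMeasure_comp_continuousAt {E F : Type*} [PseudoMetricSpace E]
    [PseudoMetricSpace F] {Y : ι → α → E} {c : E} {g : E → F} (hg : ContinuousAt g c)
    (hY : TendstoInMeasure μ Y l fun _ => c) :
    TendstoInMeasure μ (fun i ω => g (Y i ω)) l fun _ => g c := by
  refine tendstoInMeasure_of_subset hY fun ε hε => ?_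
  obtain ⟨δ, hδ, H⟩ := Metric.continuousAt_iff.1 hg ε hε
  refine ⟨δ, hδ, fun i => ae_of_all _ fun ω hω => ?_⟩
  by_contra hh
  exact absurd (H (not_le.1 hh)) (not_lt.2 hω)

theorem tendstoInMeasure_pi {κ : Type*} [Fintype κ] {E : Type*} [PseudoMetricSpace E]
    {Y : ι → α → κ → E} {c : κ → E}
    (h : ∀ k, TendstoInMeasure μ (fun i ω => Y i ω k) l fun _ => c k) :
    TendstoInMeasure μ Y l fun _ => c := by
  simp only [tendstoInMeasure_iff_dist] at h ⊢
  intro ε hε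
  have hsum : Tendsto (fun i => ∑ k, μ {ω | ε ≤ dist (Y i ω k) (c k)}) l (𝓝 0) := by
    simpa using tendsto_finsetSum Finset.univ fun k _ => h k ε hε
  refine tendsto_of_tendsto_of_tendsto_of_le_of_le tendsto_const_nhds hsum
    (fun _ => zero_le) fun i => ?_
  refine (measure_mono ?_).trans (measure_iUnion_fintype_le μ _)
  intro ω hω
  by_contra hh
  simp only [Set.mem_iUnion, Set.mem_ofPred_eq, not_exists, not_le] at hh
  exact absurd ((dist_pi_lt_iff hε).2 hh) (not_lt.2 hω)

theorem tendstoInMeasure_add {Y Z : ι → α → ℝ} {a b : ℝ}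
    (hY : TendstoInMeasure μ Y l fun _ => a) (hZ : TendstoInMeasure μ Z l fun _ => b) :
    TendstoInMeasure μ (fun i ω => Y i ω + Z i ω) l fun _ => a + b := by
  have h := tendstoInMeasure_pi (Y := fun i ω => ![Y i ω, Z i ω]) (c := ![a, b]) (μ := μ) (l := l)
    (fun k => by fin_cases k <;> simpa)
  simpa using tendstoInMeasure_comp_continuousAt
    (g := fun v : Fin 2 → ℝ => v 0 + v 1) (by fun_prop) h

theorem tendstoInMeasure_sum {κ : Type*} [Fintype κ] {Y : ι → α → κ → ℝ}
    (h : ∀ k, TendstoInMeasure μ (fun i ω => Y i ω k) l fun _ => 0) :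
    TendstoInMeasure μ (fun i ω => ∑ k, Y i ω k) l fun _ => 0 := by
  simpa using tendstoInMeasure_comp_continuousAt (g := fun v : κ → ℝ => ∑ k, v k)
    (by fun_prop) (tendstoInMeasure_pi (c := fun _ => (0 : ℝ)) h)

theorem tendstoInMeasure_zero_of_abs_le {Y Z : ι → α → ℝ}
    (hY : TendstoInMeasure μ Y l fun _ => 0) (h : ∀ i, ∀ᵐ ω ∂μ, |Z i ω| ≤ |Y i ω|) :
    TendstoInMeasure μ Z l fun _ => 0 := by
  refine tendstoInMeasure_of_subset hY fun ε hε => ⟨ε, hε, fun i => ?_⟩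
  filter_upwards [h i] with ω hω hε
  simp only [Real.dist_eq, sub_zero] at hε ⊢
  exact hε.trans hω

/-- `O_P(1) · o_P(1) = o_P(1)`. -/
theorem BoundedInProbability.mul_tendstoInMeasure {Z Y : ℕ → α → ℝ}
    (hZ : BoundedInProbability μ Z) (hY : TendstoInMeasure μ Y atTop fun _ => 0) :
    TendstoInMeasure μ (fun n ω => Z n ω * Y n ω) atTop fun _ => 0 := by
  simp only [tendstoInMeasure_iff_dist, Real.dist_eq, sub_zero] at hY ⊢
  intro ε hε
  rw [ENNReal.tendsto_nhds_zero]
  intro η hη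
  obtain ⟨η', hη', hηle⟩ : ∃ η' : ℝ, 0 < η' ∧ ENNReal.ofReal η' + ENNReal.ofReal η' ≤ η := by
    obtain rfl | htop := eq_or_ne η ⊤
    · exact ⟨1, one_pos, le_top⟩
    · refine ⟨η.toReal / 2, half_pos (ENNReal.toReal_pos hη.ne' htop), ?_⟩
      rw [← ENNReal.ofReal_add (by positivity) (by positivity), add_halves,
        ENNReal.ofReal_toReal htop]
  obtain ⟨K, hK⟩ := hZ η' hη'
  -- `K` carries no sign; `|K| + 1` is a bound for `|Z n|` that can also be divided by.
  have hpos : 0 < |K| + 1 := by positivity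
  have hY' := ENNReal.tendsto_nhds_zero.1 (hY (ε / (|K| + 1)) (by positivity))
    (ENNReal.ofReal η') (by simpa)
  filter_upwards [hK, hY'] with n h1 h2
  refine ((measure_mono ?_).trans (measure_union_le _ _)).trans ((add_le_add h1 h2).trans hηle)
  intro ω hω
  by_contra hh
  simp only [Set.mem_union, Set.mem_ofPred_eq, not_or, not_lt, not_le] at hh hω
  have h3 : |Z n ω| ≤ |K| + 1 := by linarith [hh.1, le_abs_self K]
  have h4 : |Z n ω| * |Y n ω| < ε := by
    calc |Z n ω| * |Y n ω| ≤ (|K| + 1) * |Y n ω| := by gcongr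
      _ < (|K| + 1) * (ε / (|K| + 1)) := by gcongr; exact hh.2
      _ = ε := by field_simp
  rw [abs_mul] at hω
  linarith

theorem tendstoInMeasure_const_of_tendsto {a : ℕ → ℝ} {b : ℝ} (h : Tendsto a atTop (𝓝 b)) :
    TendstoInMeasure μ (fun n _ => a n) atTop fun _ => b := by
  rw [tendstoInMeasure_iff_dist]
  intro ε hε
  refine tendsto_const_nhds.congr' ?_
  filter_upwards [Metric.tendsto_nhds.1 h ε hε] with n hn
  simp [not_le.2 hn]

theorem tendstoInMeasure_tendsto_mul {a : ℕ → ℝ} {b c : ℝ} {Y : ℕ → α → ℝ}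
    (ha : Tendsto a atTop (𝓝 b)) (hY : TendstoInMeasure μ Y atTop fun _ => c) :
    TendstoInMeasure μ (fun n ω => a n * Y n ω) atTop fun _ => b * c := by
  have h := tendstoInMeasure_pi (Y := fun n ω => ![a n, Y n ω]) (c := ![b, c]) (μ := μ)
    (l := atTop)
    (fun k => by
      fin_cases k
      · simpa using tendstoInMeasure_const_of_tendsto ha
      · simpa using hY)
  simpa using tendstoInMeasure_comp_continuousAt
    (g := fun v : Fin 2 → ℝ => v 0 * v 1) (by fun_prop) h

end ConvergenceInMeasure

/-! ### Law of large numbers, multivariate central limit theorem, linear images of Gaussians. -/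

section LimitTheorems

variable {Ω : Type*} [MeasurableSpace Ω] {P : Measure Ω}

theorem tendstoInMeasure_mean [IsFiniteMeasure P] {Z : ℕ → Ω → ℝ} (hint : Integrable (Z 0) P)
    (hindep : iIndepFun Z P) (hident : ∀ i, IdentDistrib (Z i) (Z 0) P P) :
    TendstoInMeasure P (fun (n : ℕ) ω => (n : ℝ)⁻¹ * ∑ i ∈ Finset.range n, Z i ω) atTop
      fun _ => ∫ ω, Z 0 ω ∂P := by
  refine tendstoInMeasure_of_tendsto_ae (fun n => ?_) ?_
  · refine AEMeasurable.aestronglyMeasurable ?_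
    exact (Finset.aemeasurable_fun_sum _ fun i _ => (hident i).aemeasurable_fst).const_mul _
  · filter_upwards [strong_law_ae_real Z hint (fun i j hij => hindep.indepFun hij) hident]
      with ω hω
    simpa [div_eq_inv_mul] using hω

variable {p : ℕ}

theorem dotProduct_secondMoment {ξ : Ω → EuclideanSpace ℝ (Fin p)}
    (hL2 : ∀ j, MemLp (fun ω => ξ ω j) 2 P) (t : Fin p → ℝ) :
    t ⬝ᵥ secondMoment P ξ *ᵥ t = ∫ ω, (∑ j, ξ ω j * t j) ^ 2 ∂P := by
  have hint : ∀ j k, Integrable (fun ω => ξ ω j * ξ ω k) P := fun j k =>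
    (hL2 j).integrable_mul (hL2 k)
  have h : ∀ ω, (∑ j, ξ ω j * t j) ^ 2 = ∑ j, ∑ k, t j * t k * (ξ ω j * ξ ω k) := by
    intro ω
    rw [sq, Finset.sum_mul_sum]
    exact Finset.sum_congr rfl fun j _ => Finset.sum_congr rfl fun k _ => by ring
  simp_rw [h]
  rw [integral_finsetSum _ fun j _ => integrable_finsetSum _ fun k _ => (hint j k).const_mul _]
  simp only [dotProduct, Matrix.mulVec, secondMoment, Matrix.of_apply, Finset.mul_sum]
  refine Finset.sum_congr rfl fun j _ => ?_
  rw [integral_finsetSum _ fun k _ => (hint j k).const_mul _]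
  refine Finset.sum_congr rfl fun k _ => ?_
  rw [integral_const_mul]
  ring

theorem posSemidef_secondMoment {ξ : Ω → EuclideanSpace ℝ (Fin p)}
    (hL2 : ∀ j, MemLp (fun ω => ξ ω j) 2 P) : (secondMoment P ξ).PosSemidef := by
  refine Matrix.PosSemidef.of_dotProduct_mulVec_nonneg ?_ fun t => ?_
  · ext j k
    simp [secondMoment, mul_comm]
  · simpa [dotProduct_secondMoment hL2] using
      integral_nonneg fun ω => sq_nonneg (∑ j, ξ ω j * t j)

/-- The central limit theorem for centred i.i.d. random vectors. -/
theorem tendstoInDistribution_inv_sqrt_smul_sum [IsProbabilityMeasure P]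
    {ξ : ℕ → Ω → EuclideanSpace ℝ (Fin p)}
    (hL2 : ∀ j, MemLp (fun ω => ξ 0 ω j) 2 P) (hmean : ∀ j, ∫ ω, ξ 0 ω j ∂P = 0)
    (hindep : iIndepFun ξ P) (hident : ∀ i, IdentDistrib (ξ i) (ξ 0) P P) :
    TendstoInDistribution (fun (n : ℕ) ω => (√(n : ℝ))⁻¹ • ∑ i ∈ Finset.range n, ξ i ω) atTop id
      (fun _ => P) (multivariateGaussian 0 (secondMoment P (ξ 0))) where
  forall_aemeasurable n := by
    have hms : AEMeasurable (fun ω => ∑ i ∈ Finset.range n, ξ i ω) P :=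
      Finset.aemeasurable_fun_sum _ fun i _ => (hident i).aemeasurable_fst
    exact hms.const_smul (√(n : ℝ))⁻¹
  aemeasurable_limit := aemeasurable_id
  tendsto := by
    refine ProbabilityMeasure.tendsto_iff_tendsto_charFun.2 fun t => ?_
    have hinner : ∀ v : EuclideanSpace ℝ (Fin p), ⟪v, t⟫ = ∑ j, v j * t j := fun v => by
      simp [PiLp.inner_apply, mul_comm]
    have hmeas : Measurable fun v : EuclideanSpace ℝ (Fin p) => ⟪v, t⟫ := by fun_prop
    have h2 : MemLp (fun ω => ⟪ξ 0 ω, t⟫) 2 P := by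
      simp_rw [hinner]
      exact memLp_finsetSum _ fun j _ => (hL2 j).mul_const (t j)
    have h0 : ∫ ω, ⟪ξ 0 ω, t⟫ ∂P = 0 := by
      simp_rw [hinner]
      rw [integral_finsetSum _ fun j _ => ((hL2 j).integrable one_le_two).mul_const _]
      simp [integral_mul_const, hmean]
    have hvar : Var[fun ω => ⟪ξ 0 ω, t⟫; P] = t ⬝ᵥ secondMoment P (ξ 0) *ᵥ t := by
      rw [variance_of_integral_eq_zero h2.aemeasurable h0, dotProduct_secondMoment hL2]
      simp_rw [hinner]
    -- Cramér–Wold: the characteristic function of a vector at `t` is that of its projection `⟪·,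
    -- t⟫` at `1`, so the scalar central limit theorem suffices.
    have key := tendstoInDistribution_inv_sqrt_mul_sum_sub
      (X := fun i ω => ⟪ξ i ω, t⟫) (P := P) (Y := id)
      (P' := gaussianReal 0 Var[fun ω => ⟪ξ 0 ω, t⟫; P].toNNReal) ⟨aemeasurable_id, by simp⟩ h2
      (hindep.comp (fun _ v => ⟪v, t⟫) fun _ => hmeas) fun i => (hident i).comp hmeas
    have key1 := ProbabilityMeasure.tendsto_iff_tendsto_charFun.1 key.tendsto 1
    have hG : charFun (multivariateGaussian 0 (secondMoment P (ξ 0))) t =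
        charFun (gaussianReal 0 Var[fun ω => ⟪ξ 0 ω, t⟫; P].toNNReal) 1 := by
      rw [charFun_multivariateGaussian (posSemidef_secondMoment hL2), charFun_gaussianReal, ← hvar,
        Real.coe_toNNReal _ (variance_nonneg _ _)]
      simp
    simp only [ProbabilityMeasure.coe_mk, Measure.map_id] at key1 ⊢
    rw [hG]
    refine key1.congr fun n => ?_
    have hms : AEMeasurable (fun ω => ∑ i ∈ Finset.range n, ξ i ω) P :=
      Finset.aemeasurable_fun_sum _ fun i _ => (hident i).aemeasurable_fst
    rw [charFun_apply, charFun_apply, integral_map, integral_map]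
    · simp [h0, sum_inner, inner_smul_left]
    · exact hms.const_smul (√(n : ℝ))⁻¹
    · exact Measurable.aestronglyMeasurable (by fun_prop)
    · refine ((Finset.aemeasurable_fun_sum _ fun i _ => ?_).sub_const _).const_mul _
      exact hmeas.comp_aemeasurable (hident i).aemeasurable_fst
    · exact Measurable.aestronglyMeasurable (by fun_prop)

/-- Compare characteristic functions, moving `L` across the inner product: `⟪L v, t⟫ = ⟪v, Lᵀ t⟫`.
-/
theorem map_mulVec_multivariateGaussian {S : Matrix (Fin p) (Fin p) ℝ} (hS : S.PosSemidef)
    (L : Matrix (Fin p) (Fin p) ℝ) :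
    (multivariateGaussian 0 S).map (fun v : EuclideanSpace ℝ (Fin p) => WithLp.toLp 2 (L *ᵥ v.ofLp)) =
      multivariateGaussian 0 (L * S * Lᵀ) := by
  have hS' : (L * S * Lᵀ).PosSemidef := by
    simpa [Matrix.conjTranspose_eq_transpose_of_trivial] using hS.mul_mul_conjTranspose_same L
  have hm : Measurable fun v : EuclideanSpace ℝ (Fin p) =>
      WithLp.toLp 2 (L *ᵥ v.ofLp) := by
    fun_prop
  have := Measure.isProbabilityMeasure_map (μ := multivariateGaussian 0 S) hm.aemeasurable
  refine Measure.ext_of_charFun ?_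
  ext t
  rw [charFun_multivariateGaussian hS', charFun_apply, integral_map hm.aemeasurable
    (Measurable.aestronglyMeasurable (by fun_prop))]
  have h := charFun_multivariateGaussian (μ := 0) hS (WithLp.toLp 2 (Lᵀ *ᵥ t))
  rw [charFun_apply] at h
  have hin : ∀ v : EuclideanSpace ℝ (Fin p), ⟪WithLp.toLp 2 (L *ᵥ v), t⟫ =
      ⟪v, WithLp.toLp 2 (Lᵀ *ᵥ t)⟫ := by
    intro v
    simp only [EuclideanSpace.inner_eq_star_dotProduct, star_trivial]
    rw [Matrix.dotProduct_mulVec, Matrix.mulVec_transpose]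
  simp_rw [hin, h]
  have hq : (Lᵀ *ᵥ (t : Fin p → ℝ)) ⬝ᵥ S *ᵥ (Lᵀ *ᵥ t) = t ⬝ᵥ (L * S * Lᵀ) *ᵥ t := by
    rw [← Matrix.mulVec_mulVec, ← Matrix.mulVec_mulVec, Matrix.dotProduct_mulVec t L,
      Matrix.mulVec_transpose]
  simp only [inner_zero_right, hq]

end LimitTheorems

/-! ### Integrability of products. -/

section Moments

variable {Ω : Type*} [MeasurableSpace Ω] {P : Measure Ω}

/-- Supplies the exponents for which `MemLp.mul` puts a product of two `L⁴` functions in `L²`. -/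
instance holderTriple_four_four_two : ENNReal.HolderTriple 4 4 2 where
  inv_add_inv_eq_inv := by
    have h : (4 : ENNReal) = 2 * 2 := by norm_num
    rw [h, ENNReal.mul_inv (by simp) (by simp), ← mul_add, ENNReal.inv_two_add_inv_two, mul_one]

theorem memLp_four_of_integrable {Z : Ω → ℝ} (hZ : AEStronglyMeasurable Z P)
    (h : Integrable (fun ω => Z ω ^ 4) P) : MemLp Z 4 P := by
  rw [← integrable_norm_rpow_iff hZ (by simp) (by simp)]
  refine h.congr (ae_of_all _ fun ω => ?_)
  dsimp only
  have : (4 : ENNReal).toReal = (4 : ℕ) := by simp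
  rw [this, Real.rpow_natCast, Real.norm_eq_abs, Even.pow_abs (by decide)]

/-- Independence factorizes the second moment of the product, so no moments beyond the second are
needed, unlike in Hölder's inequality. -/
theorem memLp_two_mul_of_indepFun {Y Z : Ω → ℝ} (h : IndepFun Y Z P) (hY : MemLp Y 2 P)
    (hZ : MemLp Z 2 P) : MemLp (fun ω => Y ω * Z ω) 2 P := by
  have hm : AEStronglyMeasurable (fun ω => Y ω * Z ω) P := hY.1.mul hZ.1
  rw [memLp_two_iff_integrable_sq hm]
  have h2 : IndepFun (fun ω => Y ω ^ 2) (fun ω => Z ω ^ 2) P :=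
    h.comp (measurable_id.pow_const 2) (measurable_id.pow_const 2)
  refine (h2.integrable_mul hY.integrable_sq hZ.integrable_sq).congr (ae_of_all _ fun ω => ?_)
  simp [mul_pow]

end Moments

/-! ### Consequences of the model: negligible weight perturbations and orthogonality of `g`. -/

section Model

variable {Ω : Type*} [MeasurableSpace Ω] {P : Measure Ω} {p M : ℕ}
  {D : Type*} {f : EuclideanSpace ℝ (Fin p) → ℝ} {x : ℕ → Ω → EuclideanSpace ℝ (Fin p)}
  {σ ε : ℕ → Ω → ℝ} {m : ℕ → Ω → Fin M} {W : (n : ℕ) → Ω → Matrix (Fin n) (Fin n) ℝ}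
  {S : Set ℝ} {w h : ℝ → ℝ} {d : ℝ → D → ℝ} {δ : ℕ → Fin M → Ω → ℝ} {δ₀ : ℕ → Ω → D}

theorem IsSamplingModel.tendstoInMeasure_mean [IsProbabilityMeasure P]
    (H : IsSamplingModel P x σ ε m)
    {F : EuclideanSpace ℝ (Fin p) × ℝ × Fin M × ℝ → ℝ} (hF : Measurable F)
    (hint : Integrable (fun ω => F (x 0 ω, σ 0 ω, m 0 ω, ε 0 ω)) P) :
    TendstoInMeasure P
      (fun (n : ℕ) ω => (n : ℝ)⁻¹ * ∑ i ∈ Finset.range n, F (x i ω, σ i ω, m i ω, ε i ω)) atTop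
      fun _ => ∫ ω, F (x 0 ω, σ 0 ω, m 0 ω, ε 0 ω) ∂P :=
  MisspecWLS.tendstoInMeasure_mean (Z := fun i ω => F (x i ω, σ i ω, m i ω, ε i ω)) hint
    (H.indep.comp (fun _ => F) fun _ => hF) fun i => (H.identDistrib i).comp hF

theorem tendsto_inv_sqrt_natCast :
    Tendsto (fun n : ℕ => (√(n : ℝ))⁻¹) atTop (𝓝 0) :=
  tendsto_inv_atTop_zero.comp (Real.tendsto_sqrt_atTop.comp tendsto_natCast_atTop_atTop)

/-- The perturbation of the weights contributes negligibly to a weighted sum as soon as the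
category-wise averages multiplying the random coefficients `δ n k` are negligible. -/
theorem WeightForm.tendstoInMeasure_remainder [IsProbabilityMeasure P]
    (HW : WeightForm P σ m W S w h d δ δ₀)
    (H : IsSamplingModel P x σ ε m)
    {F : EuclideanSpace ℝ (Fin p) × ℝ × Fin M × ℝ → ℝ} (hF : Measurable F)
    (hint : Integrable (fun ω => F (x 0 ω, σ 0 ω, m 0 ω, ε 0 ω)) P)
    {a : ℕ → ℝ} (ha : ∀ n, |a n| ≤ 1)
    (hzero : ∀ k, TendstoInMeasure P (fun (n : ℕ) ω => a n * ((n : ℝ)⁻¹ *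
      ∑ i ∈ Finset.range n, if m i ω = k then
        h (σ i ω) * F (x i ω, σ i ω, m i ω, ε i ω) else 0)) atTop fun _ => 0) :
    TendstoInMeasure P (fun (n : ℕ) ω => a n * ((√(n : ℝ))⁻¹ *
      ∑ i : Fin n, (W n ω i i - w (σ i ω)) * F (x i ω, σ i ω, m i ω, ε i ω))) atTop
      fun _ => 0 := by
  -- The factor `a` serves two normalizations: `a n = n^{-1/2}` for the Gram matrix and `a n = 1`
  -- for the score.
  obtain ⟨δ', hδ', hd⟩ := HW.d_bounded
  set G : ℕ → Ω → ℝ := fun i ω => F (x i ω, σ i ω, m i ω, ε i ω) with hG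
  have hmain : TendstoInMeasure P (fun (n : ℕ) ω => ∑ k, δ n k ω * (a n * ((n : ℝ)⁻¹ *
      ∑ i ∈ Finset.range n, if m i ω = k then h (σ i ω) * G i ω else 0))) atTop fun _ => 0 :=
    tendstoInMeasure_sum fun k => (HW.δ_bounded k).mul_tendstoInMeasure (hzero k)
  -- The `d` term is at most `|δ' n| · n^{-1/2}` times the average of `|F|`, and that average
  -- converges.
  have habs := H.tendstoInMeasure_mean (F := fun t => |F t|)
    (continuous_abs.measurable.comp hF) hint.abs
  have hbound := hδ'.mul_tendstoInMeasure
    (by simpa using tendstoInMeasure_tendsto_mul tendsto_inv_sqrt_natCast habs)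
  have hrest : TendstoInMeasure P (fun (n : ℕ) ω =>
      a n * ((√(n : ℝ))⁻¹ * ∑ i : Fin n, (W n ω i i - w (σ i ω)) * G i ω) -
      ∑ k, δ n k ω * (a n * ((n : ℝ)⁻¹ *
      ∑ i ∈ Finset.range n, if m i ω = k then h (σ i ω) * G i ω else 0))) atTop fun _ => 0 := by
    refine tendstoInMeasure_zero_of_abs_le hbound fun n => ?_
    filter_upwards [HW.entries n, hd n, ae_all_iff.2 HW.mem_S] with ω hent hdn hS
    -- Exchanging the sums, only `k = m i ω` survives for each `i`, which recovers the `n^{-1/2}`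
    -- part of the perturbation.
    have h1 : ∑ k, δ n k ω * (a n * ((n : ℝ)⁻¹ *
        ∑ i ∈ Finset.range n, if m i ω = k then h (σ i ω) * G i ω else 0)) =
        a n * ((√(n : ℝ))⁻¹ * ∑ i : Fin n,
          ((√(n : ℝ))⁻¹ * δ n (m i ω) ω * h (σ i ω)) * G i ω) := by
      simp only [Finset.sum_range, Finset.mul_sum]
      rw [Finset.sum_comm]
      refine Finset.sum_congr rfl fun i _ => ?_
      simp only [mul_ite, mul_zero, Finset.sum_ite_eq, Finset.mem_univ, if_true]
      have hn : (n : ℝ)⁻¹ = (√(n : ℝ))⁻¹ * (√(n : ℝ))⁻¹ := by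
        rw [← mul_inv, Real.mul_self_sqrt (Nat.cast_nonneg n)]
      rw [hn]
      ring
    have h2 : ∑ i : Fin n, (W n ω i i - w (σ i ω)) * G i ω =
        ∑ i : Fin n, ((√(n : ℝ))⁻¹ * δ n (m i ω) ω * h (σ i ω)) * G i ω +
          (n : ℝ)⁻¹ * ∑ i : Fin n, d (σ i ω) (δ₀ n ω) * G i ω := by
      rw [Finset.mul_sum, ← Finset.sum_add_distrib]
      refine Finset.sum_congr rfl fun i _ => ?_
      rw [hent i]
      ring
    rw [h1, h2, mul_add, mul_add, add_sub_cancel_left]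
    have h3 : |∑ i : Fin n, d (σ i ω) (δ₀ n ω) * G i ω| ≤
        |δ' n ω| * ∑ i : Fin n, |G i ω| := by
      rw [Finset.mul_sum]
      refine (Finset.abs_sum_le_sum_abs _ _).trans (Finset.sum_le_sum fun i _ => ?_)
      rw [abs_mul]
      refine mul_le_mul_of_nonneg_right ?_ (abs_nonneg _)
      exact (hdn _ (hS i)).trans (le_abs_self _)
    rw [Finset.sum_range]
    simp only [abs_mul, abs_inv, Nat.abs_cast, abs_of_nonneg (Real.sqrt_nonneg _)]
    rw [abs_of_nonneg (Finset.sum_nonneg fun (i : Fin n) _ => abs_nonneg (G i ω))]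
    calc |a n| * ((√(n : ℝ))⁻¹ * ((n : ℝ)⁻¹ * |∑ i : Fin n, d (σ i ω) (δ₀ n ω) * G i ω|))
        ≤ 1 * ((√(n : ℝ))⁻¹ * ((n : ℝ)⁻¹ * (|δ' n ω| * ∑ i : Fin n, |G i ω|))) := by
          gcongr
          exact ha n
      _ = |δ' n ω| * ((√(n : ℝ))⁻¹ * ((n : ℝ)⁻¹ * ∑ i : Fin n, |G i ω|)) := by ring
  simpa using tendstoInMeasure_add hmain hrest

theorem measurable_nonlinearPart (P : Measure Ω) (x : Ω → EuclideanSpace ℝ (Fin p))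
    (hf : Measurable f) : Measurable (nonlinearPart P x f) :=
  hf.sub (Finset.measurable_fun_sum _ fun j _ => by fun_prop)

theorem MomentConditions.memLp_four_mul (Hm : MomentConditions P (x 0) (σ 0) (ε 0) f)
    (H : IsSamplingModel P x σ ε m) (j k : Fin p) :
    MemLp (fun ω => x 0 ω j * x 0 ω k) 4 P := by
  have := H.measurable_x 0
  refine memLp_four_of_integrable (Measurable.aestronglyMeasurable (by fun_prop)) ?_
  simpa [mul_pow] using Hm.moment_x j k

/-- The case `j = k` of the moment condition bounds `E[x_j⁸]`: thus `x_j²` is in `L⁴`, hence in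
`L²`. -/
theorem MomentConditions.memLp_four_coord [IsProbabilityMeasure P]
    (Hm : MomentConditions P (x 0) (σ 0) (ε 0) f)
    (H : IsSamplingModel P x σ ε m) (j : Fin p) :
    MemLp (fun ω => x 0 ω j) 4 P := by
  have := H.measurable_x 0
  refine memLp_four_of_integrable (Measurable.aestronglyMeasurable (by fun_prop)) ?_
  have h2 := ((Hm.memLp_four_mul H j j).mono_exponent (p := 2) (by norm_num)).integrable_sq
  exact h2.congr (ae_of_all _ fun ω => by ring)

theorem MomentConditions.memLp_four_nonlinearPart (hf : Measurable f)
    (Hm : MomentConditions P (x 0) (σ 0) (ε 0) f) (H : IsSamplingModel P x σ ε m) :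
    MemLp (fun ω => nonlinearPart P (x 0) f (x 0 ω)) 4 P :=
  memLp_four_of_integrable
    ((measurable_nonlinearPart P (x 0) hf).comp (H.measurable_x 0)).aestronglyMeasurable
    Hm.moment_g

theorem MomentConditions.isUnit_det (Hm : MomentConditions P (x 0) (σ 0) (ε 0) f) :
    IsUnit (secondMoment P (x 0)).det := by
  rw [← Matrix.isUnit_iff_isUnit_det, ← Matrix.mulVec_surjective_iff_isUnit]
  have h := Hm.full_rank
  rw [Matrix.rank] at h
  have htop : LinearMap.range (secondMoment P (x 0)).mulVecLin = ⊤ :=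
    Submodule.eq_top_of_finrank_eq (by simpa using h)
  exact LinearMap.range_eq_top.1 htop

/-- The nonlinear part is orthogonal to the covariates. -/
theorem MomentConditions.integral_coord_mul_nonlinearPart [IsProbabilityMeasure P]
    (hf : Measurable f)
    (Hm : MomentConditions P (x 0) (σ 0) (ε 0) f) (H : IsSamplingModel P x σ ε m) (j : Fin p) :
    ∫ ω, x 0 ω j * nonlinearPart P (x 0) f (x 0 ω) ∂P = 0 := by
  have hx := Hm.memLp_four_coord H
  have hg := Hm.memLp_four_nonlinearPart hf H
  have hxg : Integrable (fun ω => x 0 ω j * nonlinearPart P (x 0) f (x 0 ω)) P :=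
    (hg.mul (r := 2) (hx j)).integrable one_le_two
  have hxx : ∀ k, Integrable (fun ω => x 0 ω j * x 0 ω k) P := fun k =>
    (Hm.memLp_four_mul H j k).integrable (by norm_num)
  have hsum : Integrable (fun ω => ∑ k, x 0 ω j * x 0 ω k * bestCoeff P (x 0) f k) P :=
    integrable_finsetSum _ fun k _ => (hxx k).mul_const _
  have hxf : ∫ ω, x 0 ω j * f (x 0 ω) ∂P =
      ∫ ω, x 0 ω j * nonlinearPart P (x 0) f (x 0 ω) ∂P +
        ∑ k, secondMoment P (x 0) j k * bestCoeff P (x 0) f k := by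
    have : ∑ k, secondMoment P (x 0) j k * bestCoeff P (x 0) f k =
        ∫ ω, ∑ k, x 0 ω j * x 0 ω k * bestCoeff P (x 0) f k ∂P := by
      rw [integral_finsetSum _ fun k _ => (hxx k).mul_const _]
      simp [integral_mul_const, secondMoment]
    rw [this, ← integral_add hxg hsum]
    refine integral_congr_ae (ae_of_all _ fun ω => ?_)
    simp only [nonlinearPart, mul_assoc, ← Finset.mul_sum]
    ring
  -- The normal equations defining `β`; with the splitting of `x f(x)` above they force the `g` part
  -- to vanish.
  have hβ : secondMoment P (x 0) *ᵥ (bestCoeff P (x 0) f : Fin p → ℝ) =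
      fun j => ∫ ω, x 0 ω j * f (x 0 ω) ∂P := by
    simp only [bestCoeff]
    rw [Matrix.mulVec_mulVec, Matrix.mul_nonsing_inv _ Hm.isUnit_det, Matrix.one_mulVec]
  have hβj := congrFun hβ j
  simp only [Matrix.mulVec, dotProduct] at hβj
  linarith

/-! ### First and second moments of the score `ψ(σ, m) x (g(x) + σ ε)`. -/

section Score

variable {ψ : ℝ × Fin M → ℝ}

/-- `x_j g(x)` is in `L²` by Hölder and is independent of the weight. The general `ψ` covers the
limiting weight `w(σ)`, the category weights `1{m = k} h(σ)` and the constant `1`. -/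
theorem memLp_weight_mul_nonlinearPart [IsProbabilityMeasure P]
    (hf : Measurable f)
    (Hm : MomentConditions P (x 0) (σ 0) (ε 0) f) (H : IsSamplingModel P x σ ε m)
    (hψ : Measurable ψ) (hψ4 : MemLp (fun ω => ψ (σ 0 ω, m 0 ω)) 4 P) (j : Fin p) :
    MemLp (fun ω => x 0 ω j * nonlinearPart P (x 0) f (x 0 ω) * ψ (σ 0 ω, m 0 ω)) 2 P := by
  have hg := measurable_nonlinearPart P (x 0) hf
  have hind : IndepFun (fun ω => x 0 ω j * nonlinearPart P (x 0) f (x 0 ω))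
      (fun ω => ψ (σ 0 ω, m 0 ω)) P :=
    H.indep_x.comp (φ := fun v => v j * nonlinearPart P (x 0) f v) (by fun_prop) hψ
  exact memLp_two_mul_of_indepFun hind
    ((Hm.memLp_four_nonlinearPart hf H).mul (r := 2) (Hm.memLp_four_coord H j))
    (hψ4.mono_exponent (by norm_num))

theorem memLp_four_noiseScale (Hm : MomentConditions P (x 0) (σ 0) (ε 0) f)
    (H : IsSamplingModel P x σ ε m) : MemLp (σ 0) 4 P :=
  memLp_four_of_integrable (H.measurable_σ 0).aestronglyMeasurable Hm.moment_σ

theorem memLp_two_noise [IsProbabilityMeasure P]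
    (Hm : MomentConditions P (x 0) (σ 0) (ε 0) f)
    (H : IsSamplingModel P x σ ε m) : MemLp (ε 0) 2 P :=
  (memLp_four_of_integrable (H.measurable_ε 0).aestronglyMeasurable Hm.moment_ε).mono_exponent
    (by norm_num)

theorem memLp_weight_mul_coord [IsProbabilityMeasure P]
    (Hm : MomentConditions P (x 0) (σ 0) (ε 0) f)
    (H : IsSamplingModel P x σ ε m)
    (hψ : Measurable ψ) (hψ4 : MemLp (fun ω => ψ (σ 0 ω, m 0 ω)) 4 P) (j : Fin p) :
    MemLp (fun ω => x 0 ω j * (ψ (σ 0 ω, m 0 ω) * σ 0 ω)) 2 P := by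
  have hind : IndepFun (fun ω => x 0 ω j) (fun ω => ψ (σ 0 ω, m 0 ω) * σ 0 ω) P :=
    H.indep_x.comp (φ := fun v : EuclideanSpace ℝ (Fin p) => v j)
      (ψ := fun s => ψ s * s.1) (by fun_prop) (by fun_prop)
  exact memLp_two_mul_of_indepFun hind ((Hm.memLp_four_coord H j).mono_exponent (by norm_num))
    ((memLp_four_noiseScale Hm H).mul (r := 2) hψ4)

theorem memLp_weight_mul_noise [IsProbabilityMeasure P]
    (Hm : MomentConditions P (x 0) (σ 0) (ε 0) f)
    (H : IsSamplingModel P x σ ε m)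
    (hψ : Measurable ψ) (hψ4 : MemLp (fun ω => ψ (σ 0 ω, m 0 ω)) 4 P) (j : Fin p) :
    MemLp (fun ω => x 0 ω j * (ψ (σ 0 ω, m 0 ω) * σ 0 ω) * ε 0 ω) 2 P := by
  have hind : IndepFun (fun ω => x 0 ω j * (ψ (σ 0 ω, m 0 ω) * σ 0 ω)) (ε 0) P :=
    (H.indep_ε.comp (φ := id) (ψ := fun t : EuclideanSpace ℝ (Fin p) × ℝ × Fin M =>
      t.1 j * (ψ (t.2.1, t.2.2) * t.2.1)) measurable_id (by fun_prop)).symm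
  exact memLp_two_mul_of_indepFun hind (memLp_weight_mul_coord Hm H hψ hψ4 j)
    (memLp_two_noise Hm H)

theorem IsSamplingModel.integral_mul_noise (H : IsSamplingModel P x σ ε m)
    {φ : EuclideanSpace ℝ (Fin p) × ℝ × Fin M → ℝ} (hφ : Measurable φ) :
    ∫ ω, φ (x 0 ω, σ 0 ω, m 0 ω) * ε 0 ω ∂P = 0 := by
  have hind : IndepFun (fun ω => φ (x 0 ω, σ 0 ω, m 0 ω)) (ε 0) P :=
    (H.indep_ε.comp (φ := id) measurable_id hφ).symm
  have hmeas : Measurable fun ω => φ (x 0 ω, σ 0 ω, m 0 ω) :=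
    hφ.comp ((H.measurable_x 0).prodMk ((H.measurable_σ 0).prodMk (H.measurable_m 0)))
  rw [hind.integral_fun_mul_eq_mul_integral hmeas.aestronglyMeasurable
    (H.measurable_ε 0).aestronglyMeasurable, H.mean_ε, mul_zero]

/-- Separates misspecification from noise, with the factors grouped so that each independence
hypothesis applies directly. -/
theorem score_eq_add (P : Measure Ω) (x : ℕ → Ω → EuclideanSpace ℝ (Fin p))
    (f : EuclideanSpace ℝ (Fin p) → ℝ) (σ ε : ℕ → Ω → ℝ) (m : ℕ → Ω → Fin M)
    (ψ : ℝ × Fin M → ℝ) (j : Fin p) :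
    (fun ω => ψ (σ 0 ω, m 0 ω) *
      (x 0 ω j * (nonlinearPart P (x 0) f (x 0 ω) + σ 0 ω * ε 0 ω))) =
    fun ω => x 0 ω j * nonlinearPart P (x 0) f (x 0 ω) * ψ (σ 0 ω, m 0 ω) +
      x 0 ω j * (ψ (σ 0 ω, m 0 ω) * σ 0 ω) * ε 0 ω := by
  funext ω
  ring

theorem memLp_score [IsProbabilityMeasure P]
    (hf : Measurable f)
    (Hm : MomentConditions P (x 0) (σ 0) (ε 0) f) (H : IsSamplingModel P x σ ε m)
    (hψ : Measurable ψ) (hψ4 : MemLp (fun ω => ψ (σ 0 ω, m 0 ω)) 4 P) (j : Fin p) :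
    MemLp (fun ω => ψ (σ 0 ω, m 0 ω) *
      (x 0 ω j * (nonlinearPart P (x 0) f (x 0 ω) + σ 0 ω * ε 0 ω))) 2 P := by
  rw [score_eq_add]
  exact (memLp_weight_mul_nonlinearPart hf Hm H hψ hψ4 j).add
    (memLp_weight_mul_noise Hm H hψ hψ4 j)

/-- This centring, valid for every weight `ψ(σ, m)`, is what makes an estimated weight harmless. The
misspecification part factorizes and `E[x g(x)] = 0`; the noise part is killed by `E[ε] = 0`. -/
theorem integral_score [IsProbabilityMeasure P]
    (hf : Measurable f)
    (Hm : MomentConditions P (x 0) (σ 0) (ε 0) f) (H : IsSamplingModel P x σ ε m)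
    (hψ : Measurable ψ) (hψ4 : MemLp (fun ω => ψ (σ 0 ω, m 0 ω)) 4 P) (j : Fin p) :
    ∫ ω, ψ (σ 0 ω, m 0 ω) *
      (x 0 ω j * (nonlinearPart P (x 0) f (x 0 ω) + σ 0 ω * ε 0 ω)) ∂P = 0 := by
  have hg := measurable_nonlinearPart P (x 0) hf
  have hx := H.measurable_x 0
  have hσm := (H.measurable_σ 0).prodMk (H.measurable_m 0)
  rw [score_eq_add,
    integral_add ((memLp_weight_mul_nonlinearPart hf Hm H hψ hψ4 j).integrable one_le_two)
      ((memLp_weight_mul_noise Hm H hψ hψ4 j).integrable one_le_two)]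
  have h1 := (H.indep_x.comp (φ := fun v => v j * nonlinearPart P (x 0) f v)
    (by fun_prop) hψ).integral_fun_mul_eq_mul_integral
      (Measurable.aestronglyMeasurable (by fun_prop)) (hψ.comp hσm).aestronglyMeasurable
  simp only [Function.comp_apply] at h1
  rw [h1, Hm.integral_coord_mul_nonlinearPart hf H, zero_mul, zero_add]
  exact H.integral_mul_noise (φ := fun t => t.1 j * (ψ (t.2.1, t.2.2) * t.2.1)) (by fun_prop)

theorem integral_score_mul_score [IsProbabilityMeasure P]
    (hf : Measurable f)
    (Hm : MomentConditions P (x 0) (σ 0) (ε 0) f) (H : IsSamplingModel P x σ ε m)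
    (hψ : Measurable ψ) (hψ4 : MemLp (fun ω => ψ (σ 0 ω, m 0 ω)) 4 P) (j k : Fin p) :
    ∫ ω, (ψ (σ 0 ω, m 0 ω) *
        (x 0 ω j * (nonlinearPart P (x 0) f (x 0 ω) + σ 0 ω * ε 0 ω))) *
      (ψ (σ 0 ω, m 0 ω) *
        (x 0 ω k * (nonlinearPart P (x 0) f (x 0 ω) + σ 0 ω * ε 0 ω))) ∂P =
    (∫ ω, ψ (σ 0 ω, m 0 ω) ^ 2 ∂P) * misspecMoment P (x 0) f j k +
      (∫ ω, σ 0 ω ^ 2 * ψ (σ 0 ω, m 0 ω) ^ 2 ∂P) * secondMoment P (x 0) j k := by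
  have hg := measurable_nonlinearPart P (x 0) hf
  have hx := H.measurable_x 0
  have hσ := H.measurable_σ 0
  have hε := H.measurable_ε 0
  have hσm := hσ.prodMk (H.measurable_m 0)
  have hψσ : Measurable fun ω => ψ (σ 0 ω, m 0 ω) := hψ.comp hσm
  have ha := memLp_weight_mul_nonlinearPart hf Hm H hψ hψ4
  have hb := memLp_weight_mul_noise Hm H hψ hψ4
  have haa : ∫ ω, (x 0 ω j * nonlinearPart P (x 0) f (x 0 ω) * ψ (σ 0 ω, m 0 ω)) *
      (x 0 ω k * nonlinearPart P (x 0) f (x 0 ω) * ψ (σ 0 ω, m 0 ω)) ∂P =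
      (∫ ω, ψ (σ 0 ω, m 0 ω) ^ 2 ∂P) * misspecMoment P (x 0) f j k := by
    have h1 := (H.indep_x.comp (φ := fun v => nonlinearPart P (x 0) f v ^ 2 * (v j * v k))
      (ψ := fun s => ψ s ^ 2) (by fun_prop) (by fun_prop)).integral_fun_mul_eq_mul_integral
        (Measurable.aestronglyMeasurable (by fun_prop))
        (hψσ.pow_const 2).aestronglyMeasurable
    simp only [Function.comp_apply] at h1
    simp only [misspecMoment, Matrix.of_apply]
    rw [mul_comm, ← h1]
    exact integral_congr_ae (ae_of_all _ fun ω => by ring)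
  have hbb : ∫ ω, (x 0 ω j * (ψ (σ 0 ω, m 0 ω) * σ 0 ω) * ε 0 ω) *
      (x 0 ω k * (ψ (σ 0 ω, m 0 ω) * σ 0 ω) * ε 0 ω) ∂P =
      (∫ ω, σ 0 ω ^ 2 * ψ (σ 0 ω, m 0 ω) ^ 2 ∂P) * secondMoment P (x 0) j k := by
    have hε2 : ∫ ω, ε 0 ω ^ 2 ∂P = 1 := by
      rw [← H.var_ε, variance_of_integral_eq_zero hε.aemeasurable H.mean_ε]
    have h1 := (H.indep_x.comp (φ := fun v => v j * v k)
      (ψ := fun s => s.1 ^ 2 * ψ s ^ 2) (by fun_prop)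
        (by fun_prop)).integral_fun_mul_eq_mul_integral
        (Measurable.aestronglyMeasurable (by fun_prop))
        (Measurable.aestronglyMeasurable (by
          exact (hσ.pow_const 2).mul (hψσ.pow_const 2)))
    have h2 := (H.indep_ε.comp (φ := fun e => e ^ 2)
      (ψ := fun t : EuclideanSpace ℝ (Fin p) × ℝ × Fin M =>
        (t.1 j * t.1 k) * (t.2.1 ^ 2 * ψ (t.2.1, t.2.2) ^ 2)) (by fun_prop)
        (by fun_prop)).integral_fun_mul_eq_mul_integral
        (hε.pow_const 2).aestronglyMeasurable
        (Measurable.aestronglyMeasurable (by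
          have hxj : Measurable fun ω => x 0 ω j * x 0 ω k := by fun_prop
          exact hxj.mul ((hσ.pow_const 2).mul (hψσ.pow_const 2))))
    simp only [Function.comp_apply] at h1 h2
    simp only [secondMoment, Matrix.of_apply]
    rw [hε2, one_mul] at h2
    rw [mul_comm (∫ ω, σ 0 ω ^ 2 * _ ∂P), ← h1, ← h2]
    exact integral_congr_ae (ae_of_all _ fun ω => by ring)
  -- The cross terms are linear in `ε`, which is centred and independent of the remaining factors.
  have hab : ∀ j k : Fin p,
      ∫ ω, (x 0 ω j * nonlinearPart P (x 0) f (x 0 ω) * ψ (σ 0 ω, m 0 ω)) *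
        (x 0 ω k * (ψ (σ 0 ω, m 0 ω) * σ 0 ω) * ε 0 ω) ∂P = 0 := fun j k => by
    rw [← H.integral_mul_noise (φ := fun t => (t.1 j * nonlinearPart P (x 0) f t.1 *
      ψ (t.2.1, t.2.2)) * (t.1 k * (ψ (t.2.1, t.2.2) * t.2.1))) (by fun_prop)]
    exact integral_congr_ae (ae_of_all _ fun ω => by ring)
  have hexp : ∀ ω, (ψ (σ 0 ω, m 0 ω) *
        (x 0 ω j * (nonlinearPart P (x 0) f (x 0 ω) + σ 0 ω * ε 0 ω))) *
      (ψ (σ 0 ω, m 0 ω) *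
        (x 0 ω k * (nonlinearPart P (x 0) f (x 0 ω) + σ 0 ω * ε 0 ω))) =
      ((x 0 ω j * nonlinearPart P (x 0) f (x 0 ω) * ψ (σ 0 ω, m 0 ω)) *
        (x 0 ω k * nonlinearPart P (x 0) f (x 0 ω) * ψ (σ 0 ω, m 0 ω)) +
      (x 0 ω j * (ψ (σ 0 ω, m 0 ω) * σ 0 ω) * ε 0 ω) *
        (x 0 ω k * (ψ (σ 0 ω, m 0 ω) * σ 0 ω) * ε 0 ω)) +
      ((x 0 ω j * nonlinearPart P (x 0) f (x 0 ω) * ψ (σ 0 ω, m 0 ω)) *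
        (x 0 ω k * (ψ (σ 0 ω, m 0 ω) * σ 0 ω) * ε 0 ω) +
      (x 0 ω k * nonlinearPart P (x 0) f (x 0 ω) * ψ (σ 0 ω, m 0 ω)) *
        (x 0 ω j * (ψ (σ 0 ω, m 0 ω) * σ 0 ω) * ε 0 ω)) := fun ω => by ring
  have iaa := (ha j).integrable_mul (ha k)
  have ibb := (hb j).integrable_mul (hb k)
  have iab := (ha j).integrable_mul (hb k)
  have iba := (ha k).integrable_mul (hb j)
  calc _ = _ := integral_congr_ae (ae_of_all _ hexp)
    _ = _ := integral_add (iaa.add ibb) (iab.add iba)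
    _ = _ := congrArg₂ (· + ·) (integral_add iaa ibb) (integral_add iab iba)
    _ = (_ + _) + (0 + 0) :=
      congrArg₂ (· + ·) (congrArg₂ (· + ·) haa hbb) (congrArg₂ (· + ·) (hab j k) (hab k j))
    _ = _ := by rw [add_zero, add_zero]

end Score

end Model

/-! ### Measurability and continuity of matrix inversion. -/

section MatrixInverse

variable {p : ℕ}

/-- Holds for singular `T` as well, both sides being `0`. Inversion is therefore measurable
everywhere and continuous wherever the determinant is nonzero. -/
theorem matrix_inv_apply (T : Matrix (Fin p) (Fin p) ℝ) (j k : Fin p) :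
    T⁻¹ j k = T.det⁻¹ * T.adjugate j k := by
  rw [Matrix.inv_def, Ring.inverse_eq_inv', Matrix.smul_apply, smul_eq_mul]

theorem continuous_det_of : Continuous fun T : Fin p → Fin p → ℝ => (Matrix.of T).det :=
  Continuous.matrix_det continuous_id

theorem continuous_adjugate_of (j k : Fin p) :
    Continuous fun T : Fin p → Fin p → ℝ => (Matrix.of T).adjugate j k :=
  (Continuous.matrix_adjugate (A := fun T : Fin p → Fin p → ℝ => Matrix.of T)
    continuous_id).matrix_elem j k

theorem measurable_matrix_inv :
    Measurable fun (T : Fin p → Fin p → ℝ) j k => (Matrix.of T)⁻¹ j k := by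
  refine measurable_pi_lambda _ fun j => measurable_pi_lambda _ fun k => ?_
  simp_rw [matrix_inv_apply]
  exact continuous_det_of.measurable.inv.mul (continuous_adjugate_of j k).measurable

theorem continuousAt_matrix_inv {T : Fin p → Fin p → ℝ} (hT : (Matrix.of T).det ≠ 0) :
    ContinuousAt (fun (T : Fin p → Fin p → ℝ) j k => (Matrix.of T)⁻¹ j k) T := by
  refine continuousAt_pi.2 fun j => continuousAt_pi.2 fun k => ?_
  simp_rw [matrix_inv_apply]
  exact (continuous_det_of.continuousAt.inv₀ hT).mul (continuous_adjugate_of j k).continuousAt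

end MatrixInverse

/-- The normalized weighted Gram matrix `n⁻¹ Xᵀ W X` of a diagonal weight matrix. -/
noncomputable def weightedGram {Ω : Type*} {p : ℕ} (x : ℕ → Ω → EuclideanSpace ℝ (Fin p))
    (W : (n : ℕ) → Ω → Matrix (Fin n) (Fin n) ℝ) (n : ℕ) (ω : Ω) : Fin p → Fin p → ℝ :=
  fun j k => (n : ℝ)⁻¹ * ∑ i : Fin n, W n ω i i * (x i ω j * x i ω k)

/-- The normalized weighted score `n^{-1/2} Xᵀ W (Y - Xβ)` of a diagonal weight matrix, where the
residuals are written `g(xᵢ) + σᵢ εᵢ`. -/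
noncomputable def weightedScore {Ω : Type*} {p : ℕ} (g : EuclideanSpace ℝ (Fin p) → ℝ)
    (x : ℕ → Ω → EuclideanSpace ℝ (Fin p)) (σ ε : ℕ → Ω → ℝ)
    (W : (n : ℕ) → Ω → Matrix (Fin n) (Fin n) ℝ) (n : ℕ) (ω : Ω) : EuclideanSpace ℝ (Fin p) :=
  WithLp.toLp 2 fun j => (√(n : ℝ))⁻¹ *
    ∑ i : Fin n, W n ω i i * (x i ω j * (g (x i ω) + σ i ω * ε i ω))

/-! ### Decomposition of the estimator and limits of its two factors. -/

section Model

variable {Ω : Type*} [MeasurableSpace Ω] {P : Measure Ω} {p M : ℕ}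
  {D : Type*} {f : EuclideanSpace ℝ (Fin p) → ℝ} {x : ℕ → Ω → EuclideanSpace ℝ (Fin p)}
  {σ ε : ℕ → Ω → ℝ} {m : ℕ → Ω → Fin M} {W : (n : ℕ) → Ω → Matrix (Fin n) (Fin n) ℝ}
  {S : Set ℝ} {w h : ℝ → ℝ} {d : ℝ → D → ℝ} {δ : ℕ → Fin M → Ω → ℝ} {δ₀ : ℕ → Ω → D}

/-- Weighted least squares reproduces linear responses exactly, so substituting `Y = X β +
residuals` leaves only the residual term; the powers of `n` are then distributed over the two
factors. -/
theorem sqrt_smul_wlsEstimator_sub (n : ℕ) (ω : Ω) (hdiag : (W n ω).IsDiag)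
    (hdet : (Matrix.of (weightedGram x W n ω)).det ≠ 0) :
    √(n : ℝ) • (wlsEstimator (designMatrix x n ω) (W n ω) (response f x σ ε n ω) -
      bestCoeff P (x 0) f) =
    WithLp.toLp 2 ((Matrix.of (weightedGram x W n ω))⁻¹ *ᵥ
      (weightedScore (nonlinearPart P (x 0) f) x σ ε W n ω : Fin p → ℝ)) := by
  -- For `n = 0` both sides vanish: `√0 = 0` on the left, an empty sum in the score on the right.
  obtain rfl | hn := Nat.eq_zero_or_pos n
  · ext j
    simp [weightedScore, Matrix.mulVec, dotProduct]
  have hn' : (0 : ℝ) < n := Nat.cast_pos.2 hn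
  have hsq : √(n : ℝ) * √(n : ℝ) = n := Real.mul_self_sqrt hn'.le
  have hs0 : √(n : ℝ) ≠ 0 := (Real.sqrt_pos.2 hn').ne'
  set X := designMatrix x n ω
  set A : Matrix (Fin p) (Fin p) ℝ := Matrix.of (weightedGram x W n ω) with hA
  set β : EuclideanSpace ℝ (Fin p) := bestCoeff P (x 0) f
  set s : EuclideanSpace ℝ (Fin p) := weightedScore (nonlinearPart P (x 0) f) x σ ε W n ω with hs
  have hW : W n ω = Matrix.diagonal fun i => W n ω i i := hdiag.diagonal_diag.symm
  have hG : Xᵀ * W n ω * X = (n : ℝ) • A := by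
    ext j k
    rw [hW, Matrix.mul_apply]
    simp only [Matrix.mul_diagonal, Matrix.smul_apply, smul_eq_mul, hA, Matrix.of_apply,
      weightedGram]
    rw [mul_inv_cancel_left₀ hn'.ne']
    refine Finset.sum_congr rfl fun i _ => ?_
    simp only [X, designMatrix, Matrix.transpose_apply, Matrix.of_apply]
    ring
  have hscore : Xᵀ *ᵥ (W n ω *ᵥ fun i : Fin n =>
      nonlinearPart P (x 0) f (x i ω) + σ i ω * ε i ω) = √(n : ℝ) • (s : Fin p → ℝ) := by
    ext j
    rw [hW]
    simp only [Matrix.mulVec, dotProduct, Pi.smul_apply, smul_eq_mul, hs,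
      weightedScore]
    rw [mul_inv_cancel_left₀ hs0]
    simp only [Matrix.diagonal_apply, ite_mul, zero_mul, Finset.sum_ite_eq, Finset.mem_univ,
      if_true]
    refine Finset.sum_congr rfl fun i _ => ?_
    simp only [X, designMatrix, Matrix.transpose_apply, Matrix.of_apply]
    ring
  have hY : response f x σ ε n ω = X *ᵥ (β : Fin p → ℝ) + fun i : Fin n =>
      nonlinearPart P (x 0) f (x i ω) + σ i ω * ε i ω := by
    ext i
    simp only [response, X, β, designMatrix, Pi.add_apply, Matrix.mulVec, dotProduct,
      Matrix.of_apply, nonlinearPart]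
    ring
  have hdet' : IsUnit ((n : ℝ) • A).det := by
    rw [Matrix.det_smul]
    exact (mul_ne_zero (pow_ne_zero _ hn'.ne') hdet).isUnit
  have hinv : ((n : ℝ) • A)⁻¹ = (n : ℝ)⁻¹ • A⁻¹ := by
    have := Matrix.inv_smul' A (Units.mk0 (n : ℝ) hn'.ne') hdet.isUnit
    simpa [Units.smul_def] using this
  have hest : ((n : ℝ) • A)⁻¹ *ᵥ (Xᵀ *ᵥ (W n ω *ᵥ response f x σ ε n ω)) =
      (β : Fin p → ℝ) + (√(n : ℝ))⁻¹ • (A⁻¹ *ᵥ (s : Fin p → ℝ)) := by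
    rw [hY, Matrix.mulVec_add, Matrix.mulVec_add, hscore, Matrix.mulVec_mulVec,
      Matrix.mulVec_mulVec, hG, Matrix.mulVec_add, Matrix.mulVec_mulVec,
      Matrix.nonsing_inv_mul _ hdet', Matrix.one_mulVec, hinv, Matrix.smul_mulVec,
      Matrix.mulVec_smul, smul_smul]
    congr 2
    have hn2 : (n : ℝ)⁻¹ = (√(n : ℝ))⁻¹ * (√(n : ℝ))⁻¹ := by rw [← mul_inv, hsq]
    rw [hn2, mul_assoc, inv_mul_cancel₀ hs0, mul_one]
  simp only [wlsEstimator]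
  rw [hG, hest]
  ext j
  simp only [PiLp.smul_apply, PiLp.sub_apply, Pi.add_apply, Pi.smul_apply, smul_eq_mul,
    add_sub_cancel_left]
  rw [mul_inv_cancel_left₀ hs0]

theorem measurable_wlsEstimator (hf : Measurable f) (H : IsSamplingModel P x σ ε m)
    (HW : WeightForm P σ m W S w h d δ δ₀) (n : ℕ) :
    Measurable fun ω =>
      wlsEstimator (designMatrix x n ω) (W n ω) (response f x σ ε n ω) := by
  have hx := H.measurable_x
  have hσ := H.measurable_σ
  have hε := H.measurable_ε
  have hW := HW.measurable_W
  have hG : Measurable fun ω j k =>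
      ((designMatrix x n ω)ᵀ * W n ω * designMatrix x n ω) j k := by
    refine measurable_pi_lambda _ fun j => measurable_pi_lambda _ fun k => ?_
    simp only [Matrix.mul_apply, designMatrix, Matrix.transpose_apply, Matrix.of_apply]
    fun_prop
  have hinv := measurable_matrix_inv.comp hG
  have hv : Measurable fun ω =>
      (designMatrix x n ω)ᵀ *ᵥ (W n ω *ᵥ response f x σ ε n ω) := by
    refine measurable_pi_lambda _ fun j => ?_
    simp only [Matrix.mulVec, dotProduct, designMatrix, Matrix.transpose_apply, Matrix.of_apply,
      response]
    fun_prop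
  have hcoord : Measurable fun ω =>
      ((designMatrix x n ω)ᵀ * W n ω * designMatrix x n ω)⁻¹ *ᵥ
        ((designMatrix x n ω)ᵀ *ᵥ (W n ω *ᵥ response f x σ ε n ω)) := by
    refine measurable_pi_lambda _ fun j => ?_
    simp only [Matrix.mulVec, dotProduct]
    refine Finset.measurable_fun_sum _ fun k _ => ?_
    exact ((measurable_pi_apply k).comp ((measurable_pi_apply j).comp hinv)).mul
      ((measurable_pi_apply k).comp hv)
  exact (WithLp.measurable_toLp 2 _).comp hcoord

theorem measurable_weightedGram (H : IsSamplingModel P x σ ε m)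
    (HW : WeightForm P σ m W S w h d δ δ₀) (n : ℕ) : Measurable (weightedGram x W n) := by
  have hx := H.measurable_x
  have hW := HW.measurable_W
  refine measurable_pi_lambda _ fun j => measurable_pi_lambda _ fun k => ?_
  simp only [weightedGram]
  fun_prop

theorem measurable_weightedScore {g : EuclideanSpace ℝ (Fin p) → ℝ} (hg : Measurable g)
    (H : IsSamplingModel P x σ ε m) (HW : WeightForm P σ m W S w h d δ δ₀) (n : ℕ) :
    Measurable (weightedScore g x σ ε W n) := by
  have hx := H.measurable_x
  have hσ := H.measurable_σ
  have hε := H.measurable_ε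
  have hW := HW.measurable_W
  refine (WithLp.measurable_toLp 2 _).comp (measurable_pi_lambda _ fun j => ?_)
  fun_prop

theorem WeightForm.memLp_four_weight (HW : WeightForm P σ m W S w h d δ δ₀)
    (H : IsSamplingModel P x σ ε m) : MemLp (fun ω => w (σ 0 ω)) 4 P :=
  memLp_four_of_integrable (HW.measurable_w.comp (H.measurable_σ 0)).aestronglyMeasurable
    HW.moment_w

/-- Together with full rank, this makes the limiting Gram matrix invertible. -/
theorem WeightForm.integral_weight_pos [IsProbabilityMeasure P]
    (HW : WeightForm P σ m W S w h d δ δ₀) (H : IsSamplingModel P x σ ε m) :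
    0 < ∫ ω, w (σ 0 ω) ∂P := by
  have hpos : ∀ᵐ ω ∂P, 0 < w (σ 0 ω) := (HW.mem_S 0).mono fun ω hω => HW.w_pos _ hω
  have hnonneg : 0 ≤ᵐ[P] fun ω => w (σ 0 ω) := hpos.mono fun ω hω => hω.le
  refine lt_of_le_of_ne (integral_nonneg_of_ae hnonneg) fun h0 => ?_
  have hae := (integral_eq_zero_iff_of_nonneg_ae hnonneg
    ((HW.memLp_four_weight H).integrable (by norm_num))).1 h0.symm
  obtain ⟨ω, h1, h2⟩ := (hpos.and hae).exists
  exact h1.ne' h2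

theorem WeightForm.memLp_four_category [IsProbabilityMeasure P]
    (HW : WeightForm P σ m W S w h d δ δ₀) (H : IsSamplingModel P x σ ε m) (k : Fin M) :
    MemLp (fun ω => if m 0 ω = k then h (σ 0 ω) else 0) 4 P := by
  obtain ⟨C, hC⟩ := HW.h_bounded
  have hmeas : Measurable fun ω => if m 0 ω = k then h (σ 0 ω) else 0 :=
    Measurable.ite (H.measurable_m 0 (measurableSet_singleton k))
      (HW.measurable_h.comp (H.measurable_σ 0)) measurable_const
  refine MemLp.of_bound hmeas.aestronglyMeasurable C ?_
  filter_upwards [HW.mem_S 0] with ω hω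
  split_ifs
  · exact hC _ hω
  · simpa using (abs_nonneg _).trans (hC _ hω)

theorem measurable_category (hh : Measurable h) (k : Fin M) :
    Measurable fun s : ℝ × Fin M => if s.2 = k then h s.1 else 0 :=
  Measurable.ite (measurable_snd (measurableSet_singleton k)) (hh.comp measurable_fst)
    measurable_const

theorem abs_inv_sqrt_natCast_le_one (n : ℕ) : |(√(n : ℝ))⁻¹| ≤ 1 := by
  rw [abs_of_nonneg (by positivity)]
  obtain rfl | hn := Nat.eq_zero_or_pos n
  · simp
  · exact inv_le_one_of_one_le₀ (Real.one_le_sqrt.2 (by exact_mod_cast hn))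

theorem tendstoInMeasure_weightedGram [IsProbabilityMeasure P]
    (Hm : MomentConditions P (x 0) (σ 0) (ε 0) f) (H : IsSamplingModel P x σ ε m)
    (HW : WeightForm P σ m W S w h d δ δ₀) :
    TendstoInMeasure P (weightedGram x W) atTop
      fun _ j k => ((∫ ω, w (σ 0 ω) ∂P) • secondMoment P (x 0)) j k := by
  refine tendstoInMeasure_pi fun j => tendstoInMeasure_pi fun k => ?_
  have hx := H.measurable_x 0
  have hw := HW.measurable_w
  have hxx := Hm.memLp_four_mul H j k
  have hF : Measurable fun t : EuclideanSpace ℝ (Fin p) × ℝ × Fin M × ℝ => t.1 j * t.1 k := by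
    fun_prop
  -- The Gram matrix is normalized by `n⁻¹`, which leaves a spare `n^{-1/2}`: the category averages
  -- need only converge, not be centred.
  have hrem := HW.tendstoInMeasure_remainder H hF (hxx.integrable (by norm_num))
    (a := fun n => (√(n : ℝ))⁻¹) abs_inv_sqrt_natCast_le_one fun l => by
      have hmean := H.tendstoInMeasure_mean
        (F := fun t => (if t.2.2.1 = l then h t.2.1 else 0) * (t.1 j * t.1 k))
        (((measurable_category HW.measurable_h l).comp
          (measurable_snd.fst.prodMk measurable_snd.snd.fst)).mul hF)
        ((hxx.mul (r := 2) (HW.memLp_four_category H l)).integrable one_le_two)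
      simpa [ite_mul] using tendstoInMeasure_tendsto_mul tendsto_inv_sqrt_natCast hmean
  have hmean := H.tendstoInMeasure_mean (F := fun t => w t.2.1 * (t.1 j * t.1 k)) (by fun_prop)
    ((hxx.mul (r := 2) (HW.memLp_four_weight H)).integrable one_le_two)
  have hlim : ∫ ω, w (σ 0 ω) * (x 0 ω j * x 0 ω k) ∂P =
      (∫ ω, w (σ 0 ω) ∂P) * secondMoment P (x 0) j k := by
    have h1 := (H.indep_x.comp (φ := fun v => v j * v k) (ψ := fun s : ℝ × Fin M => w s.1) (by fun_prop)
      (by fun_prop)).integral_fun_mul_eq_mul_integral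
        (Measurable.aestronglyMeasurable (by fun_prop))
        (Measurable.aestronglyMeasurable (by exact hw.comp (H.measurable_σ 0)))
    simp only [Function.comp_apply] at h1
    simp only [secondMoment, Matrix.of_apply]
    rw [mul_comm (∫ ω, w _ ∂P), ← h1]
    exact integral_congr_ae (ae_of_all _ fun ω => mul_comm _ _)
  have hsum := tendstoInMeasure_add hmean hrem
  simp only [hlim, add_zero] at hsum
  simp only [Matrix.smul_apply, smul_eq_mul]
  convert hsum using 2 with n
  · funext ω
    have hn : (n : ℝ)⁻¹ = (√(n : ℝ))⁻¹ * (√(n : ℝ))⁻¹ := by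
      rw [← mul_inv, Real.mul_self_sqrt (Nat.cast_nonneg n)]
    rw [Finset.sum_range, ← mul_assoc (√(n : ℝ))⁻¹, ← hn, ← mul_add, ← Finset.sum_add_distrib]
    simp only [weightedGram]
    congr 1
    exact Finset.sum_congr rfl fun i _ => by ring

/-- Here no spare power of `n` is available; the category averages tend to zero because
`integral_score` makes them centred. -/
theorem tendstoInMeasure_score_remainder [IsProbabilityMeasure P] (hf : Measurable f)
    (Hm : MomentConditions P (x 0) (σ 0) (ε 0) f) (H : IsSamplingModel P x σ ε m)
    (HW : WeightForm P σ m W S w h d δ δ₀) (j : Fin p) :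
    TendstoInMeasure P (fun (n : ℕ) ω => (√(n : ℝ))⁻¹ * ∑ i : Fin n,
      (W n ω i i - w (σ i ω)) *
        (x i ω j * (nonlinearPart P (x 0) f (x i ω) + σ i ω * ε i ω))) atTop fun _ => 0 := by
  have hg := measurable_nonlinearPart P (x 0) hf
  have hF : Measurable fun t : EuclideanSpace ℝ (Fin p) × ℝ × Fin M × ℝ =>
      t.1 j * (nonlinearPart P (x 0) f t.1 + t.2.1 * t.2.2.2) := by fun_prop
  have hint : Integrable (fun ω =>
      x 0 ω j * (nonlinearPart P (x 0) f (x 0 ω) + σ 0 ω * ε 0 ω)) P := by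
    simpa using (memLp_score hf Hm H (ψ := fun _ => 1) measurable_const
      (memLp_const 1) j).integrable one_le_two
  have hrem := HW.tendstoInMeasure_remainder H hF hint (a := fun _ => 1) (by simp) fun l => by
    have hψ := measurable_category HW.measurable_h l
    have hmean := H.tendstoInMeasure_mean
      (F := fun t => (if t.2.2.1 = l then h t.2.1 else 0) *
        (t.1 j * (nonlinearPart P (x 0) f t.1 + t.2.1 * t.2.2.2)))
      ((hψ.comp (measurable_snd.fst.prodMk measurable_snd.snd.fst)).mul hF)
      ((memLp_score hf Hm H hψ (HW.memLp_four_category H l) j).integrable one_le_two)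
    have h0 := integral_score hf Hm H hψ (HW.memLp_four_category H l) j
    simp only at h0
    rw [h0] at hmean
    simpa only [one_mul, ite_mul, zero_mul] using hmean
  simpa only [one_mul] using hrem

theorem secondMoment_score [IsProbabilityMeasure P] (hf : Measurable f)
    (Hm : MomentConditions P (x 0) (σ 0) (ε 0) f) (H : IsSamplingModel P x σ ε m)
    (HW : WeightForm P σ m W S w h d δ δ₀) :
    secondMoment P (fun ω => WithLp.toLp 2 fun j => w (σ 0 ω) *
      (x 0 ω j * (nonlinearPart P (x 0) f (x 0 ω) + σ 0 ω * ε 0 ω))) =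
      (∫ ω, w (σ 0 ω) ^ 2 ∂P) • misspecMoment P (x 0) f +
        (∫ ω, σ 0 ω ^ 2 * w (σ 0 ω) ^ 2 ∂P) • secondMoment P (x 0) := by
  ext j k
  exact integral_score_mul_score hf Hm H (ψ := fun s => w s.1)
    (HW.measurable_w.comp measurable_fst) (HW.memLp_four_weight H) j k

theorem posSemidef_score [IsProbabilityMeasure P] (hf : Measurable f)
    (Hm : MomentConditions P (x 0) (σ 0) (ε 0) f) (H : IsSamplingModel P x σ ε m)
    (HW : WeightForm P σ m W S w h d δ δ₀) :
    ((∫ ω, w (σ 0 ω) ^ 2 ∂P) • misspecMoment P (x 0) f +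
      (∫ ω, σ 0 ω ^ 2 * w (σ 0 ω) ^ 2 ∂P) • secondMoment P (x 0)).PosSemidef := by
  rw [← secondMoment_score hf Hm H HW]
  exact posSemidef_secondMoment (memLp_score hf Hm H (ψ := fun s => w s.1)
    (HW.measurable_w.comp measurable_fst) (HW.memLp_four_weight H))

/-- The score with weights `w(σᵢ)` is a normalized i.i.d. sum, and exchanging them for the entries
of `W` costs `o_P(1)`. -/
theorem tendstoInDistribution_weightedScore [IsProbabilityMeasure P] (hf : Measurable f)
    (Hm : MomentConditions P (x 0) (σ 0) (ε 0) f) (H : IsSamplingModel P x σ ε m)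
    (HW : WeightForm P σ m W S w h d δ δ₀) :
    TendstoInDistribution (weightedScore (nonlinearPart P (x 0) f) x σ ε W) atTop id (fun _ => P)
      (multivariateGaussian 0 ((∫ ω, w (σ 0 ω) ^ 2 ∂P) • misspecMoment P (x 0) f +
        (∫ ω, σ 0 ω ^ 2 * w (σ 0 ω) ^ 2 ∂P) • secondMoment P (x 0))) := by
  have hg := measurable_nonlinearPart P (x 0) hf
  have hw := HW.measurable_w
  have hψ : Measurable fun s : ℝ × Fin M => w s.1 := hw.comp measurable_fst
  have hw4 := HW.memLp_four_weight H
  set Φ : EuclideanSpace ℝ (Fin p) × ℝ × Fin M × ℝ → EuclideanSpace ℝ (Fin p) := fun t =>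
    WithLp.toLp 2 fun j => w t.2.1 * (t.1 j * (nonlinearPart P (x 0) f t.1 + t.2.1 * t.2.2.2))
  have hΦ : Measurable Φ := (WithLp.measurable_toLp 2 _).comp
    (measurable_pi_lambda _ fun j => by fun_prop)
  have hclt := tendstoInDistribution_inv_sqrt_smul_sum (P := P)
    (ξ := fun i ω => Φ (x i ω, σ i ω, m i ω, ε i ω))
    (memLp_score hf Hm H hψ hw4) (integral_score hf Hm H hψ hw4)
    (H.indep.comp (fun _ => Φ) fun _ => hΦ) fun i => (H.identDistrib i).comp hΦ
  rw [secondMoment_score hf Hm H HW] at hclt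
  refine tendstoInDistribution_of_tendstoInMeasure_sub _ _ hclt ?_
    fun n => (measurable_weightedScore hg H HW n).aemeasurable
  have hrem := tendstoInMeasure_comp_continuousAt (g := fun v : Fin p → ℝ => WithLp.toLp 2 v)
    (by fun_prop) (tendstoInMeasure_pi (c := fun _ => (0 : ℝ))
      (Y := fun (n : ℕ) ω j => (√(n : ℝ))⁻¹ * ∑ i : Fin n, (W n ω i i - w (σ i ω)) *
        (x i ω j * (nonlinearPart P (x 0) f (x i ω) + σ i ω * ε i ω)))
      (tendstoInMeasure_score_remainder hf Hm H HW))
  convert hrem using 1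
  · funext n ω
    ext j
    simp only [Pi.sub_apply, PiLp.sub_apply, PiLp.smul_apply, WithLp.ofLp_sum, Finset.sum_apply,
      smul_eq_mul, weightedScore, Φ]
    rw [Finset.sum_range, ← mul_sub, ← Finset.sum_sub_distrib]
    congr 1
    exact Finset.sum_congr rfl fun i _ => by ring
  · rfl

/-- The sandwich form `L Σ Lᵀ` is the covariance of a linear image of a Gaussian. The noise term
collapses because `B E[x xᵀ] B = B`. -/
theorem asymptoticVariance_eq (hA : IsUnit (secondMoment P (x 0)).det)
    (hw : ∫ ω, w (σ 0 ω) ∂P ≠ 0) :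
    asymptoticVariance P (x 0) (σ 0) f w =
      ((∫ ω, w (σ 0 ω) ∂P) • secondMoment P (x 0))⁻¹ *
        ((∫ ω, w (σ 0 ω) ^ 2 ∂P) • misspecMoment P (x 0) f +
          (∫ ω, σ 0 ω ^ 2 * w (σ 0 ω) ^ 2 ∂P) • secondMoment P (x 0)) *
        (((∫ ω, w (σ 0 ω) ∂P) • secondMoment P (x 0))⁻¹)ᵀ := by
  have hinv : ((∫ ω, w (σ 0 ω) ∂P) • secondMoment P (x 0))⁻¹ =
      (∫ ω, w (σ 0 ω) ∂P)⁻¹ • (secondMoment P (x 0))⁻¹ := by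
    simpa [Units.smul_def] using Matrix.inv_smul' (secondMoment P (x 0)) (Units.mk0 _ hw) hA
  have hsymm : (secondMoment P (x 0))ᵀ = secondMoment P (x 0) := by
    ext j k
    simp [secondMoment, mul_comm]
  rw [hinv, Matrix.transpose_smul, Matrix.transpose_nonsing_inv, hsymm, asymptoticVariance]
  simp only [Matrix.smul_mul, Matrix.mul_smul, Matrix.mul_add, Matrix.add_mul, smul_smul,
    smul_add, Matrix.nonsing_inv_mul _ hA, Matrix.one_mul]
  congr 2 <;> ring

/-- Convergence in distribution only depends on the law of the limit. -/
theorem tendstoInDistribution_of_map_eq {E Ω₁ Ω₂ : Type*} [TopologicalSpace E] [MeasurableSpace E]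
    [OpensMeasurableSpace E] [MeasurableSpace Ω₁] [MeasurableSpace Ω₂] {μ₁ : Measure Ω₁}
    {μ₂ : Measure Ω₂} [IsProbabilityMeasure P] [IsProbabilityMeasure μ₁] [IsProbabilityMeasure μ₂]
    {Y : ℕ → Ω → E} {Z₁ : Ω₁ → E} {Z₂ : Ω₂ → E}
    (hY : TendstoInDistribution Y atTop Z₁ (fun _ => P) μ₁) (hZ : AEMeasurable Z₂ μ₂)
    (hmap : μ₁.map Z₁ = μ₂.map Z₂) : TendstoInDistribution Y atTop Z₂ (fun _ => P) μ₂ where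
  forall_aemeasurable := hY.forall_aemeasurable
  aemeasurable_limit := hZ
  tendsto := by
    have h : (⟨μ₁.map Z₁, Measure.isProbabilityMeasure_map hY.aemeasurable_limit⟩ :
        ProbabilityMeasure E) = ⟨μ₂.map Z₂, Measure.isProbabilityMeasure_map hZ⟩ :=
      Subtype.ext hmap
    exact h ▸ hY.tendsto

theorem tendstoInDistribution_wlsEstimator [IsProbabilityMeasure P] (hf : Measurable f)
    (Hm : MomentConditions P (x 0) (σ 0) (ε 0) f) (H : IsSamplingModel P x σ ε m)
    (HW : WeightForm P σ m W S w h d δ δ₀) :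
    TendstoInDistribution
      (fun (n : ℕ) (ω : Ω) => √(n : ℝ) •
        (wlsEstimator (designMatrix x n ω) (W n ω) (response f x σ ε n ω) -
          bestCoeff P (x 0) f))
      atTop id (fun _ => P)
      (multivariateGaussian 0 (asymptoticVariance P (x 0) (σ 0) f w)) := by
  have hw := (HW.integral_weight_pos H).ne'
  set T : Matrix (Fin p) (Fin p) ℝ := (∫ ω, w (σ 0 ω) ∂P) • secondMoment P (x 0) with hT
  have hdet : T.det ≠ 0 := by
    rw [hT, Matrix.det_smul]
    exact mul_ne_zero (pow_ne_zero _ hw) Hm.isUnit_det.ne_zero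
  have hscore := tendstoInDistribution_weightedScore hf Hm H HW
  have hgram := tendstoInMeasure_weightedGram Hm H HW
  have hcont : Continuous fun q : EuclideanSpace ℝ (Fin p) × (Fin p → Fin p → ℝ) =>
      (WithLp.toLp 2 (Matrix.of q.2 *ᵥ q.1.ofLp) : EuclideanSpace ℝ (Fin p)) := by
    refine (PiLp.continuous_toLp 2 _).comp (continuous_pi fun j => ?_)
    simp only [Matrix.mulVec, dotProduct, Matrix.of_apply]
    fun_prop
  -- Slutsky: the inverse Gram matrix tends in probability to the constant `T⁻¹`, and matrix-vector
  -- multiplication is jointly continuous.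
  have hslutsky := hscore.continuous_comp_prodMk_of_tendstoInMeasure_const hcont
    (tendstoInMeasure_comp_continuousAt (continuousAt_matrix_inv hdet) hgram)
    fun n => (measurable_matrix_inv.comp (measurable_weightedGram H HW n)).aemeasurable
  have hlim := tendstoInDistribution_of_tendstoInMeasure_sub
    (fun (n : ℕ) (ω : Ω) => √(n : ℝ) •
        (wlsEstimator (designMatrix x n ω) (W n ω) (response f x σ ε n ω) -
          bestCoeff P (x 0) f)) _ hslutsky
    (tendstoInMeasure_of_subset
      (tendstoInMeasure_comp_continuousAt continuous_det_of.continuousAt hgram)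
      -- The estimator can differ from `A_n⁻¹ s_n` only where `det A_n = 0`, up to a null set. There
      -- `det A_n` is at distance exactly `|det T| > 0` from its limit, so the probability of this
      -- event tends to zero.
      fun r hr => ⟨|T.det|, abs_pos.2 hdet, fun n => by
        filter_upwards [HW.isDiag n] with ω hdiag hω
        by_cases h0 : (Matrix.of (weightedGram x W n ω)).det = 0
        · rw [h0, Real.dist_eq, zero_sub, abs_neg]
          exact le_rfl
        · exfalso
          simp only [Pi.sub_apply, sqrt_smul_wlsEstimator_sub n ω hdiag h0] at hω
          exact hr.not_ge (hω.trans_eq (dist_eq_zero.2 (sub_self _)))⟩)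
    fun n => (((measurable_wlsEstimator hf H HW n).sub_const _).const_smul
      (√(n : ℝ))).aemeasurable
  -- The limit so far is `T⁻¹ v` with `v` Gaussian; it remains to identify its law.
  refine tendstoInDistribution_of_map_eq hlim aemeasurable_id ?_
  rw [Measure.map_id, asymptoticVariance_eq Hm.isUnit_det hw,
    ← map_mulVec_multivariateGaussian (posSemidef_score hf Hm H HW)]
  rfl

end Model

end MisspecWLS

theorem theorem1 {Ω : Type*} [MeasurableSpace Ω] (P : MeasureTheory.Measure Ω)
    [MeasureTheory.IsProbabilityMeasure P] {p M : ℕ} {D : Type*}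
    (f : EuclideanSpace ℝ (Fin p) → ℝ) (hf : Measurable f)
    (x : ℕ → Ω → EuclideanSpace ℝ (Fin p)) (σ ε : ℕ → Ω → ℝ) (m : ℕ → Ω → Fin M)
    (W : (n : ℕ) → Ω → Matrix (Fin n) (Fin n) ℝ)
    (S : Set ℝ) (w h : ℝ → ℝ) (d : ℝ → D → ℝ) (δ : ℕ → Fin M → Ω → ℝ) (δ₀ : ℕ → Ω → D)
    (hmodel : MisspecWLS.IsSamplingModel P x σ ε m)
    (hmoment : MisspecWLS.MomentConditions P (x 0) (σ 0) (ε 0) f)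
    (hweight : MisspecWLS.WeightForm P σ m W S w h d δ δ₀) :
    MeasureTheory.TendstoInDistribution
      (fun (n : ℕ) (ω : Ω) => √(n : ℝ) •
        (MisspecWLS.wlsEstimator (MisspecWLS.designMatrix x n ω) (W n ω)
            (MisspecWLS.response f x σ ε n ω)
          - MisspecWLS.bestCoeff P (x 0) f))
      Filter.atTop id (fun _ => P)
      (ProbabilityTheory.multivariateGaussian 0
        (MisspecWLS.asymptoticVariance P (x 0) (σ 0) f w)) :=
  MisspecWLS.tendstoInDistribution_wlsEstimator hf hmoment hmodel hweight
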